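/- Let $G=\prod_{k=0}^{\infty}\mathbb Z_2$ be the dyadic group (elements $x=(x_0,x_1,\dots)$, $x_k\in\{0,1\}$, coordinatewise addition modulo $2$, product topology) with its normalized Haar measure $\mu$, and put $|x|=\sum_{i\ge 0}x_i2^{-i-1}$ for $x\in G$. For an integer $n\ge 1$ with binary digits $n=\sum_k n_k2^k$ let $|n|=\max\{k:n_k\ne 0\}$, so that $2^{|n|}\le n<2^{|n|+1}$, and let $w_n(x)=(-1)^{\sum_k n_kx_k}$, $w_0=1$, be the Walsh–Paley functions. For $1\le p<\infty$ let $L_p(G)$ be the Lebesgue space of scalar (real or complex) functions with norm $\|\cdot\|_p$; for $p=\infty$ let $L_\infty(G)$ denote the space $C(G)$ of continuous functions with $\|f\|_\infty=\sup_{x\in G}|f(x)|$. For $f\in L_p(G)$ put $$\omega_p(f,\delta)=\sup_{|h|<\delta}\|f(\cdot+h)-f(\cdot)\|_p,\qquad \hat f(j)=\int_G f\,w_j\,d\mu,\qquad S_k(f)=\sum_{j=0}^{k-1}\hat f(j)w_j .$$ **Theorem 4.1.** Let $1\le p\le\infty$, $f\in L_p(G)$ and $n\ge 1$. Let $t_{1,n},\dots,t_{n,n}$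 be non-negative real numbers with $\sum_{k=1}^n t_{k,n}=1$ which are non-increasing in $k$, and let $\sigma_n^T(f)=\sum_{k=1}^n t_{k,n}S_k(f)$. Then $$\|\sigma_n^T(f)-f\|_p\le \frac{31}{15}\sum_{k=0}^{|n|-1}2^k\,t_{2^k,n}\,\omega_p\!\left(f,\frac1{2^k}\right)+\frac{47}{30}\,\omega_p\!\left(f,\frac1{2^{|n|}}\right).$$ -/

import Mathlib

open MeasureTheory
open scoped ENNReal

/-- The dyadic group: the countable product of copies of `ℤ/2ℤ`, with coordinatewise addition.
As `ℤ/2ℤ` is discrete, its topology and σ-algebra are the product ones. -/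
abbrev DyadicGroup : Type := ℕ → ZMod 2

namespace DyadicGroup

noncomputable section

/-- The normalized Haar measure: the product of the measures on `ℤ/2ℤ` giving mass `1/2`
to each point. -/
def haar : Measure DyadicGroup :=
  Measure.infinitePi fun _ : ℕ => (PMF.uniformOfFintype (ZMod 2)).toMeasure

/-- `|x| = ∑ xᵢ / 2^(i+1)`. -/
def size (x : DyadicGroup) : ℝ := ∑' i : ℕ, ((x i).val : ℝ) / 2 ^ (i + 1)

/-- The Rademacher functions `r_n(x) = (-1)^{x_n}`. -/
def rademacher (n : ℕ) (x : DyadicGroup) : ℝ := (-1) ^ (x n).val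

/-- The order `|n|` of a positive integer: `2^|n| ≤ n < 2^(|n|+1)`. -/
def order (n : ℕ) : ℕ := Nat.log 2 n

/-- The Walsh-Paley functions: the product of the `r_k` over the binary digits `1` of `n`. -/
def walsh (n : ℕ) (x : DyadicGroup) : ℝ :=
  ∏ k ∈ Finset.range (order n + 1), rademacher k x ^ (n.testBit k).toNat

variable {𝕜 : Type*} [RCLike 𝕜]

/-- The Walsh-Fourier coefficients. -/
def walshCoeff (f : DyadicGroup → 𝕜) (j : ℕ) : 𝕜 :=
  ∫ x, f x * (walsh j x : 𝕜) ∂haar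

/-- The partial sums `S_k(f)` of the Walsh-Fourier series, with `k` terms. -/
def partialSum (f : DyadicGroup → 𝕜) (k : ℕ) (x : DyadicGroup) : 𝕜 :=
  ∑ j ∈ Finset.range k, walshCoeff f j * (walsh j x : 𝕜)

/-- The matrix transform means `σ_n^T(f) = ∑_{k=1}^n t_{k,n} S_k(f)`. -/
def matrixMean (t : ℕ → ℕ → ℝ) (n : ℕ) (f : DyadicGroup → 𝕜) (x : DyadicGroup) : 𝕜 :=
  ∑ k ∈ Finset.Icc 1 n, (t k n : 𝕜) * partialSum f k x

/-- Membership in `L_p(G)`, where for `p = ∞` the space is `C(G)` by convention. -/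
def InLp (p : ℝ≥0∞) (f : DyadicGroup → 𝕜) : Prop :=
  if p = ∞ then Continuous f else MemLp f p haar

/-- The norm of `L_p(G)`: the Lebesgue norm for `p < ∞`, the supremum norm for `p = ∞`. -/
def lpNorm (p : ℝ≥0∞) (f : DyadicGroup → 𝕜) : ℝ≥0∞ :=
  if p = ∞ then ⨆ x, ‖f x‖ₑ else eLpNorm f p haar

/-- The modulus of continuity `ω_p(f, δ)`. -/
def modulus (p : ℝ≥0∞) (f : DyadicGroup → 𝕜) (δ : ℝ) : ℝ≥0∞ :=
  ⨆ (h : DyadicGroup) (_ : size h < δ), lpNorm p fun x => f (x + h) - f x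

end

end DyadicGroup

/-!
The error `σ_n^T(f) - f = ∑ t_{k,n} (S_k f - f)` is split into the dyadic blocks `2ᵐ ≤ k < 2ᵐ⁺¹`,
and in each block
`S_{2ᵐ+i} f - f = (S_{2ᵐ} f - f) + (S_{2ᵐ+i} f - S_{2ᵐ} f)`.

The first term is an average of differences `f(· + h) - f` over the subgroup where the first `m`
coordinates vanish, so its norm is at most `ω_p(f, 2⁻ᵐ)` (`lpNorm_partialSum_two_pow_sub_le`).
The second is the convolution of `f` with `r_m D_i`. The kernel `r_m ∑ tᵢ Dᵢ` changes sign under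
translation by the element `e_m` whose only nonzero coordinate is the `m`-th, so by Minkowski's
integral inequality (`lpNorm_integral_mul_le`) the weighted sum of the second terms has norm at most
`½ ω_p(f, 2⁻ᵐ) ‖∑ tᵢ Dᵢ‖₁` (`lpNorm_sum_partialSum_sub_le`). As the weights are non-increasing,
summation by parts and Yano's bound `‖K_n‖₁ ≤ 2` for the Fejér kernels
(`integral_abs_fejerSum_le`) give `‖∑ tᵢ Dᵢ‖₁ ≤ 2 ∑ tᵢ`.

Altogether a block contributes at most twice the sum of its weights times `ω_p(f, 2⁻ᵐ)`
(`lpNorm_block_le`). For a complete block this is at most `2 · 2ᵐ t_{2ᵐ,n} ω_p(f, 2⁻ᵐ)`, and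
`2 ≤ 31/15`. The weights of the last block, with index `N = |n|`, sum to at most `2/3` when
`N ≥ 1`, because the preceding `2ᴺ - 1` weights are no smaller; so its constant is at most
`4/3 ≤ 47/30`. For `N = 0` the last block is the single term `S_1 f - f`, with constant `1`.
-/

namespace DyadicGroup

/-! ### Haar measure -/

instance : IsProbabilityMeasure haar := by
  unfold haar
  infer_instance

instance : haar.IsAddLeftInvariant where
  map_add_left_eq_self c := by
    have h (i : ℕ) : Measure.map (fun a : ZMod 2 => c i + a)
        (PMF.uniformOfFintype (ZMod 2)).toMeasure =
          (PMF.uniformOfFintype (ZMod 2)).toMeasure := by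
      refine Measure.ext_of_singleton fun a => ?_
      rw [Measure.map_apply (by fun_prop) (by measurability),
        PMF.toMeasure_apply_singleton _ _ (by measurability)]
      have : (fun a => c i + a) ⁻¹' {a} = {a - c i} := by
        ext b
        simp only [Set.mem_preimage, Set.mem_singleton_iff, eq_sub_iff_add_eq, add_comm b]
      rw [this, PMF.toMeasure_apply_singleton _ _ (by measurability)]
      simp
    have := Measure.infinitePi_map_pi
      (fun _ : ℕ => (PMF.uniformOfFintype (ZMod 2)).toMeasure)
      (f := fun i a => c i + a) (fun _ => by fun_prop)
    simp only [h] at this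
    exact this

instance : NullSingletonClass haar where
  measure_singleton c := by
    have h (N : ℕ) : haar {c} ≤ (2⁻¹ : ℝ≥0∞) ^ N := by
      calc haar {c} ≤ haar ((Finset.range N : Set ℕ).pi fun i => {c i}) :=
            measure_mono (by rintro _ rfl i _; rfl)
        _ = (2⁻¹ : ℝ≥0∞) ^ N := by
            unfold haar
            rw [Measure.infinitePi_pi _ (fun _ _ => by measurability)]
            simp
    exact le_antisymm (ge_of_tendsto' (ENNReal.tendsto_pow_atTop_nhds_zero_of_lt_one
      (by simp)) h) zero_le

theorem integrable_of_continuous {E : Type*} [NormedAddCommGroup E] {K : DyadicGroup → E}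
    (hK : Continuous K) : Integrable K haar :=
  hK.integrable_of_hasCompactSupport (.of_compactSpace K)

/-! ### The size of group elements -/

/-- The element of `G` whose only nonzero coordinate is the one of index `m`. -/
def basisElem (m : ℕ) : DyadicGroup := Pi.single m 1

theorem size_basisElem_lt (m : ℕ) : size (basisElem m) < 1 / 2 ^ m := by
  have : size (basisElem m) = 1 / 2 ^ (m + 1) := by
    unfold size basisElem
    rw [tsum_eq_single m]
    · simp [ZMod.val_one]
    · intro i hi
      simp [hi]
  rw [this]
  gcongr
  · norm_num
  · omega

theorem size_lt_of_eq_zero {m k : ℕ} {h : DyadicGroup} (hm : ∀ i < m, h i = 0) (hmk : m ≤ k)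
    (hk : h k = 0) : size h < 1 / 2 ^ m := by
  set g : ℕ → ℝ := fun i => if i < m then 0 else 1 / 2 ^ (i + 1) with hg
  have hshift (i : ℕ) : g (i + m) = 1 / 2 ^ m / 2 / 2 ^ i := by
    simp only [hg, Nat.not_lt.2 (Nat.le_add_left m i), if_false]
    rw [div_div, div_div]
    ring
  have hsum : HasSum g (1 / 2 ^ m) := by
    rw [← hasSum_nat_add_iff' m, Finset.sum_eq_zero (fun i hi => by
      simp [hg, Finset.mem_range.1 hi]), sub_zero]
    simp only [hshift]
    exact hasSum_geometric_two' _
  have hle (i : ℕ) : ((h i).val : ℝ) / 2 ^ (i + 1) ≤ g i := by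
    by_cases hi : i < m
    · simp [hg, hi, hm i hi]
    · simp only [hg, hi, if_false]
      have : (h i).val ≤ 1 := Nat.lt_succ_iff.1 (ZMod.val_lt (h i))
      gcongr
      exact_mod_cast this
  rw [← hsum.tsum_eq]
  refine Summable.tsum_lt_tsum hle (i := k) ?_
    (hsum.summable.of_nonneg_of_le (fun i => by positivity) hle) hsum.summable
  simp only [hk, hg, Nat.not_lt.2 hmk, if_false]
  simp

/-- The elements whose first `m` coordinates vanish satisfy `|h| ≤ 2⁻ᵐ`, with equality only at
the one whose remaining coordinates are all `1`; hence `|h| < 2⁻ᵐ` off a null set. -/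
theorem ae_size_lt (m : ℕ) : ∀ᵐ h ∂haar, (∀ i < m, h i = 0) → size h < 1 / 2 ^ m := by
  set c : DyadicGroup := fun i => if i < m then 0 else 1
  have : ∀ᵐ h ∂haar, h ≠ c := by
    simp [ae_iff]
  filter_upwards [this] with h hc hm
  obtain ⟨k, hk⟩ := Function.ne_iff.1 hc
  by_cases hkm : k < m
  · simp [c, hkm, hm k hkm] at hk
  · simp only [c, hkm, if_false] at hk
    refine size_lt_of_eq_zero hm (Nat.not_lt.1 hkm) ?_
    generalize h k = a at hk
    revert a
    decide

/-! ### Walsh functions and Dirichlet kernels -/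

theorem rademacher_add (n : ℕ) (x y : DyadicGroup) :
    rademacher n (x + y) = rademacher n x * rademacher n y := by
  simp only [rademacher, Pi.add_apply]
  generalize x n = a
  generalize y n = b
  have key : ∀ a b : ZMod 2, (-1 : ℤ) ^ (a + b).val = (-1) ^ a.val * (-1) ^ b.val := by decide
  exact_mod_cast key a b

theorem rademacher_basisElem_self (n : ℕ) : rademacher n (basisElem n) = -1 := by
  simp [rademacher, basisElem, ZMod.val_one]

theorem rademacher_basisElem_of_ne {k n : ℕ} (h : k ≠ n) : rademacher k (basisElem n) = 1 := by
  simp [rademacher, basisElem, h]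

theorem rademacher_eq_one_or_neg_one (n : ℕ) (x : DyadicGroup) :
    x n = 0 ∧ rademacher n x = 1 ∨ rademacher n x = -1 := by
  simp only [rademacher]
  generalize x n = a
  have : a = 0 ∨ a = 1 := by revert a; decide
  rcases this with rfl | rfl <;> simp [ZMod.val_one]

theorem abs_rademacher (n : ℕ) (x : DyadicGroup) : |rademacher n x| = 1 := by
  simp [rademacher]

@[fun_prop]
theorem continuous_rademacher (n : ℕ) : Continuous (rademacher n) :=
  (continuous_of_discreteTopology (f := fun a : ZMod 2 => (-1 : ℝ) ^ a.val)).comp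
    (continuous_apply n)

@[fun_prop]
theorem continuous_walsh (n : ℕ) : Continuous (walsh n) := by
  unfold walsh
  fun_prop

theorem walsh_zero (x : DyadicGroup) : walsh 0 x = 1 := by
  simp [walsh]

theorem walsh_add (n : ℕ) (x y : DyadicGroup) : walsh n (x + y) = walsh n x * walsh n y := by
  simp only [walsh, rademacher_add, mul_pow, Finset.prod_mul_distrib]

/-- Any number of binary digits that suffices for `n` may be used to compute `w_n`. -/
theorem walsh_eq_prod_range {n N : ℕ} (h : n < 2 ^ N) (x : DyadicGroup) :
    walsh n x = ∏ k ∈ Finset.range N, rademacher k x ^ (n.testBit k).toNat := by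
  have key {A B : ℕ} (hAB : A ≤ B) (hA : n < 2 ^ A) :
      ∏ k ∈ Finset.range A, rademacher k x ^ (n.testBit k).toNat =
        ∏ k ∈ Finset.range B, rademacher k x ^ (n.testBit k).toNat := by
    refine Finset.prod_subset (by simpa using hAB) fun k _ hk => ?_
    rw [Nat.testBit_lt_two_pow (hA.trans_le (Nat.pow_le_pow_right two_pos (by simpa using hk)))]
    simp
  have hn : n < 2 ^ (order n + 1) := Nat.lt_pow_succ_log_self one_lt_two n
  rcases le_total (order n + 1) N with hN | hN
  · exact key hN hn
  · exact (key hN h).symm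

theorem walsh_two_pow_add {m j : ℕ} (hj : j < 2 ^ m) (x : DyadicGroup) :
    walsh (2 ^ m + j) x = rademacher m x * walsh j x := by
  rw [walsh_eq_prod_range (N := m + 1) (by rw [pow_succ]; omega), Finset.prod_range_succ,
    walsh_eq_prod_range hj, mul_comm, Nat.testBit_two_pow_add_eq, Nat.testBit_lt_two_pow hj]
  congr 1
  · simp
  · refine Finset.prod_congr rfl fun k hk => ?_
    rw [Nat.testBit_two_pow_add_gt (Finset.mem_range.1 hk)]

theorem walsh_basisElem {m j : ℕ} (hj : j < 2 ^ m) : walsh j (basisElem m) = 1 := by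
  rw [walsh_eq_prod_range hj]
  refine Finset.prod_eq_one fun k hk => ?_
  rw [rademacher_basisElem_of_ne (Finset.mem_range.1 hk).ne, one_pow]

/-- The Walsh functions other than `w_0` have mean zero: translation by a suitable element
changes their sign. -/
theorem integral_walsh {n : ℕ} (hn : n ≠ 0) : ∫ x, walsh n x ∂haar = 0 := by
  have h : walsh n (basisElem (order n)) = -1 := by
    have h1 : 2 ^ order n ≤ n := Nat.pow_log_le_self 2 hn
    have h2 : n < 2 ^ (order n + 1) := Nat.lt_pow_succ_log_self one_lt_two n
    obtain ⟨j, hj⟩ := Nat.exists_eq_add_of_le h1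
    have hj' : j < 2 ^ order n := by rw [pow_succ] at h2; omega
    generalize order n = m at *
    rw [hj, walsh_two_pow_add hj', rademacher_basisElem_self, walsh_basisElem hj', mul_one]
  have := integral_add_left_eq_self (μ := haar) (walsh n) (basisElem (order n))
  simp only [walsh_add, h, neg_one_mul, integral_neg] at this
  linarith

/-- The Walsh–Dirichlet kernel `D_n = w_0 + ⋯ + w_{n-1}`. -/
def dirichlet (n : ℕ) (x : DyadicGroup) : ℝ := ∑ j ∈ Finset.range n, walsh j x

@[fun_prop]
theorem continuous_dirichlet (n : ℕ) : Continuous (dirichlet n) := by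
  unfold dirichlet
  fun_prop

theorem dirichlet_two_pow_add {m j : ℕ} (hj : j ≤ 2 ^ m) (x : DyadicGroup) :
    dirichlet (2 ^ m + j) x = dirichlet (2 ^ m) x + rademacher m x * dirichlet j x := by
  simp only [dirichlet, Finset.sum_range_add, Finset.mul_sum]
  congr 1
  refine Finset.sum_congr rfl fun i hi => ?_
  rw [walsh_two_pow_add ((Finset.mem_range.1 hi).trans_le hj)]

theorem dirichlet_add_basisElem {m j : ℕ} (hj : j ≤ 2 ^ m) (x : DyadicGroup) :
    dirichlet j (x + basisElem m) = dirichlet j x := by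
  refine Finset.sum_congr rfl fun i hi => ?_
  rw [walsh_add, walsh_basisElem ((Finset.mem_range.1 hi).trans_le hj), mul_one]

theorem dirichlet_two_pow (m : ℕ) (x : DyadicGroup) :
    dirichlet (2 ^ m) x = ∏ i ∈ Finset.range m, (1 + rademacher i x) := by
  induction m with
  | zero => simp [dirichlet, walsh_zero]
  | succ m ih =>
    rw [pow_succ, mul_two, dirichlet_two_pow_add le_rfl, Finset.prod_range_succ, ← ih]
    ring

theorem dirichlet_two_pow_nonneg (m : ℕ) (x : DyadicGroup) : 0 ≤ dirichlet (2 ^ m) x := by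
  rw [dirichlet_two_pow]
  refine Finset.prod_nonneg fun i _ => ?_
  rcases rademacher_eq_one_or_neg_one i x with ⟨_, h⟩ | h <;> rw [h] <;> norm_num

theorem eq_zero_of_dirichlet_two_pow_ne_zero {m : ℕ} {x : DyadicGroup}
    (h : dirichlet (2 ^ m) x ≠ 0) : ∀ i < m, x i = 0 := by
  intro i hi
  rw [dirichlet_two_pow, Finset.prod_ne_zero_iff] at h
  rcases rademacher_eq_one_or_neg_one i x with h1 | h1
  · exact h1.1
  · exact absurd (by rw [h1]; norm_num) (h i (Finset.mem_range.2 hi))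

theorem integral_dirichlet {n : ℕ} (hn : n ≠ 0) : ∫ x, dirichlet n x ∂haar = 1 := by
  obtain ⟨n, rfl⟩ := Nat.exists_eq_succ_of_ne_zero hn
  simp only [dirichlet]
  rw [integral_finsetSum _ fun j _ => integrable_of_continuous (continuous_walsh j),
    Finset.sum_range_succ', Finset.sum_eq_zero fun j _ => integral_walsh j.succ_ne_zero]
  simp [walsh_zero]

theorem integral_abs_dirichlet_two_pow (m : ℕ) : ∫ x, |dirichlet (2 ^ m) x| ∂haar = 1 := by
  simp only [abs_of_nonneg (dirichlet_two_pow_nonneg m _)]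
  exact integral_dirichlet (by positivity)

/-! ### Fejér kernels -/

/-- `D_1 + ⋯ + D_n`, which is `n` times the Walsh–Fejér kernel `K_n`. -/
def fejerSum (n : ℕ) (x : DyadicGroup) : ℝ := ∑ i ∈ Finset.range n, dirichlet (i + 1) x

@[fun_prop]
theorem continuous_fejerSum (n : ℕ) : Continuous (fejerSum n) := by
  unfold fejerSum
  fun_prop

theorem fejerSum_two_pow_add {m j : ℕ} (hj : j ≤ 2 ^ m) (x : DyadicGroup) :
    fejerSum (2 ^ m + j) x =
      fejerSum (2 ^ m) x + j * dirichlet (2 ^ m) x + rademacher m x * fejerSum j x := by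
  have h : ∀ i ∈ Finset.range j, dirichlet (2 ^ m + (i + 1)) x =
      dirichlet (2 ^ m) x + rademacher m x * dirichlet (i + 1) x := fun i hi => by
    rw [dirichlet_two_pow_add (by have := Finset.mem_range.1 hi; omega)]
  simp only [fejerSum, Finset.sum_range_add, add_assoc]
  rw [Finset.sum_congr rfl h, Finset.sum_add_distrib, Finset.mul_sum, Finset.sum_const,
    Finset.card_range, nsmul_eq_mul]

theorem fejerSum_two_pow_nonneg (m : ℕ) (x : DyadicGroup) : 0 ≤ fejerSum (2 ^ m) x := by
  induction m with
  | zero => simp [fejerSum, dirichlet, walsh_zero]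
  | succ m ih =>
    rw [pow_succ, mul_two, fejerSum_two_pow_add le_rfl]
    have := mul_nonneg (Nat.cast_nonneg (α := ℝ) (2 ^ m)) (dirichlet_two_pow_nonneg m x)
    rcases rademacher_eq_one_or_neg_one m x with ⟨_, h⟩ | h <;> rw [h] <;> linarith

theorem integral_abs_fejerSum_two_pow (m : ℕ) :
    ∫ x, |fejerSum (2 ^ m) x| ∂haar = 2 ^ m := by
  simp only [abs_of_nonneg (fejerSum_two_pow_nonneg m _)]
  simp only [fejerSum]
  rw [integral_finsetSum _ fun j _ => integrable_of_continuous (continuous_dirichlet _),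
    Finset.sum_congr rfl fun j _ => integral_dirichlet j.succ_ne_zero]
  simp

/-- Yano's bound `‖K_n‖₁ ≤ 2`. Writing `n = 2ᵐ + j` with `j < 2ᵐ`, the recursion for `n K_n` gives
`‖n K_n‖₁ ≤ 2ᵐ + j + ‖j K_j‖₁ ≤ 2ᵐ + 3 j ≤ 2 n`. -/
theorem integral_abs_fejerSum_le (n : ℕ) : ∫ x, |fejerSum n x| ∂haar ≤ 2 * n := by
  induction n using Nat.strong_induction_on with
  | _ n ih =>
  rcases eq_or_ne n 0 with rfl | hn
  · simp [fejerSum]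
  obtain ⟨j, hj⟩ := Nat.exists_eq_add_of_le (Nat.pow_log_le_self 2 hn)
  have h2 : n < 2 ^ (Nat.log 2 n + 1) := Nat.lt_pow_succ_log_self one_lt_two n
  generalize Nat.log 2 n = m at *
  have hjm : j < 2 ^ m := by rw [pow_succ] at h2; omega
  have hjn : j < n := by have := Nat.two_pow_pos m; omega
  have hjm' : (j : ℝ) ≤ 2 ^ m := by exact_mod_cast hjm.le
  have i1 : Integrable (fun x => |fejerSum (2 ^ m) x|) haar :=
    integrable_of_continuous (by fun_prop)
  have i2 : Integrable (fun x => (j : ℝ) * |dirichlet (2 ^ m) x|) haar :=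
    integrable_of_continuous (by fun_prop)
  have i3 : Integrable (fun x => |fejerSum j x|) haar :=
    integrable_of_continuous (by fun_prop)
  calc ∫ x, |fejerSum n x| ∂haar
      ≤ ∫ x, (|fejerSum (2 ^ m) x| + j * |dirichlet (2 ^ m) x|) + |fejerSum j x| ∂haar := by
        refine integral_mono (integrable_of_continuous (by fun_prop)) ((i1.add i2).add i3) ?_
        intro x
        simp only [hj, fejerSum_two_pow_add hjm.le]
        refine (abs_add_three _ _ _).trans (le_of_eq ?_)
        rw [abs_mul, abs_mul, abs_rademacher, one_mul, Nat.abs_cast]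
    _ = 2 ^ m + j + ∫ x, |fejerSum j x| ∂haar := by
        have h12 := integral_add (i1.add i2) i3
        simp only [Pi.add_apply] at h12
        rw [h12, integral_add i1 i2, integral_const_mul,
          integral_abs_fejerSum_two_pow, integral_abs_dirichlet_two_pow, mul_one]
    _ ≤ 2 * n := by
        have := ih j hjn
        rw [hj]
        push_cast
        linarith

/-- Summation by parts turns Yano's bound into an `L_1` bound for combinations of Dirichlet kernels
with non-negative non-increasing coefficients. -/
theorem integral_abs_sum_dirichlet_le (L : ℕ) (s : ℕ → ℝ) (hs : ∀ i < L, 0 ≤ s i)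
    (hanti : ∀ i j, i ≤ j → j < L → s j ≤ s i) :
    ∫ x, |∑ i ∈ Finset.range L, s i * dirichlet (i + 1) x| ∂haar ≤
      2 * ∑ i ∈ Finset.range L, s i := by
  induction L generalizing s with
  | zero => simp
  | succ L ih =>
    have hL := hs L L.lt_succ_self
    have ih' := ih (fun i => s i - s L)
      (fun i hi => sub_nonneg.2 (hanti i L hi.le L.lt_succ_self))
      (fun i j hij hj => sub_le_sub_right (hanti i j hij (hj.trans L.lt_succ_self)) _)
    have hF := mul_le_mul_of_nonneg_left (integral_abs_fejerSum_le (L + 1)) hL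
    have i1 : Integrable (fun x => s L * |fejerSum (L + 1) x|) haar :=
      integrable_of_continuous (by fun_prop)
    have i2 : Integrable
        (fun x => |∑ i ∈ Finset.range L, (s i - s L) * dirichlet (i + 1) x|) haar :=
      integrable_of_continuous (by fun_prop)
    calc ∫ x, |∑ i ∈ Finset.range (L + 1), s i * dirichlet (i + 1) x| ∂haar
        ≤ ∫ x, s L * |fejerSum (L + 1) x| +
            |∑ i ∈ Finset.range L, (s i - s L) * dirichlet (i + 1) x| ∂haar := by
          refine integral_mono (integrable_of_continuous (by fun_prop)) (i1.add i2) ?_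
          intro x
          have : ∑ i ∈ Finset.range (L + 1), s i * dirichlet (i + 1) x =
              s L * fejerSum (L + 1) x +
                ∑ i ∈ Finset.range L, (s i - s L) * dirichlet (i + 1) x := by
            simp only [fejerSum, Finset.sum_range_succ, sub_mul, Finset.sum_sub_distrib,
              mul_add, Finset.mul_sum]
            ring
          simp only [this]
          refine (abs_add_le _ _).trans (le_of_eq ?_)
          rw [abs_mul, abs_of_nonneg hL]
      _ ≤ 2 * ∑ i ∈ Finset.range (L + 1), s i := by
          rw [integral_add i1 i2, integral_const_mul]
          rw [Finset.sum_sub_distrib, Finset.sum_const, Finset.card_range, nsmul_eq_mul] at ih'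
          rw [Finset.sum_range_succ]
          push_cast at hF
          linarith

/-! ### The norm of `L_p(G)` -/

variable {𝕜 : Type*} [RCLike 𝕜]

theorem lpNorm_add_le {p : ℝ≥0∞} (hp : 1 ≤ p) {f g : DyadicGroup → 𝕜}
    (hf : AEStronglyMeasurable f haar) (hg : AEStronglyMeasurable g haar) :
    lpNorm p (fun x => f x + g x) ≤ lpNorm p f + lpNorm p g := by
  unfold lpNorm
  split_ifs
  · exact iSup_le fun x => (enorm_add_le _ _).trans
      (add_le_add (le_iSup (fun x => ‖f x‖ₑ) x) (le_iSup (fun x => ‖g x‖ₑ) x))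
  · exact eLpNorm_add_le hf hg hp

theorem lpNorm_zero (p : ℝ≥0∞) : lpNorm p (fun _ => (0 : 𝕜)) = 0 := by
  unfold lpNorm
  split_ifs <;> simp

theorem lpNorm_sum_le {p : ℝ≥0∞} (hp : 1 ≤ p) {ι : Type*} (s : Finset ι)
    {f : ι → DyadicGroup → 𝕜} (hf : ∀ i, AEStronglyMeasurable (f i) haar) :
    lpNorm p (fun x => ∑ i ∈ s, f i x) ≤ ∑ i ∈ s, lpNorm p (f i) := by
  classical
  induction s using Finset.induction_on with
  | empty => simp [lpNorm_zero]
  | insert a s ha ih =>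
    simp only [Finset.sum_insert ha]
    refine (lpNorm_add_le hp (hf a) ?_).trans (add_le_add le_rfl ih)
    exact s.aestronglyMeasurable_fun_sum fun i _ => hf i

theorem lpNorm_const_mul (p : ℝ≥0∞) (c : 𝕜) (f : DyadicGroup → 𝕜) :
    lpNorm p (fun x => c * f x) = ‖c‖ₑ * lpNorm p f := by
  unfold lpNorm
  split_ifs
  · simp only [enorm_mul, ENNReal.mul_iSup]
  · exact eLpNorm_const_smul c f p haar

theorem measurePreserving_add_const (y : DyadicGroup) :
    MeasurePreserving (fun x => x + y) haar haar := by
  simpa only [add_comm] using measurePreserving_add_left haar y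

theorem lpNorm_comp_add_right (p : ℝ≥0∞) {f : DyadicGroup → 𝕜}
    (hf : AEStronglyMeasurable f haar) (y : DyadicGroup) :
    lpNorm p (fun x => f (x + y)) = lpNorm p f := by
  unfold lpNorm
  split_ifs
  · exact (Equiv.addRight y).iSup_comp (g := fun x => ‖f x‖ₑ)
  · exact eLpNorm_comp_measurePreserving hf (measurePreserving_add_const y)

theorem lintegral_enorm_eq {K : DyadicGroup → ℝ} (hK : Continuous K) :
    ∫⁻ y, ‖K y‖ₑ ∂haar = ENNReal.ofReal (∫ y, |K y| ∂haar) := by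
  rw [ofReal_integral_eq_lintegral_ofReal (integrable_of_continuous hK.abs)
    (.of_forall fun y => abs_nonneg _)]
  simp only [Real.enorm_eq_ofReal_abs]

/-- The integral form of Minkowski's inequality, for a weight `K`. For `p < ∞` it follows from
Hölder's inequality on the finite measure `|K| dμ` and Tonelli's theorem. -/
theorem lpNorm_integral_mul_le {p : ℝ≥0∞} (hp : 1 ≤ p) {g : DyadicGroup → DyadicGroup → 𝕜}
    (hg : AEStronglyMeasurable (Function.uncurry g) (haar.prod haar)) {K : DyadicGroup → ℝ}
    (hK : Continuous K) {ω : ℝ≥0∞}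
    (hω : ∀ᵐ y ∂haar, K y ≠ 0 → lpNorm p (fun x => g x y) ≤ ω) :
    lpNorm p (fun x => ∫ y, g x y * (K y : 𝕜) ∂haar) ≤
      ENNReal.ofReal (∫ y, |K y| ∂haar) * ω := by
  have hW : Measurable fun y => ‖K y‖ₑ := hK.measurable.enorm
  have hKn (y : DyadicGroup) : ‖(K y : 𝕜)‖ₑ = ‖K y‖ₑ := by
    simp [← ofReal_norm]
  have hpt (x : DyadicGroup) :
      ‖∫ y, g x y * (K y : 𝕜) ∂haar‖ₑ ≤ ∫⁻ y, ‖g x y‖ₑ * ‖K y‖ₑ ∂haar := by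
    refine (enorm_integral_le_lintegral_enorm _).trans (le_of_eq ?_)
    simp only [enorm_mul, hKn]
  rw [← lintegral_enorm_eq hK]
  set M := ∫⁻ y, ‖K y‖ₑ ∂haar with hM
  have hMtop : M ≠ ∞ := (integrable_of_continuous hK).2.ne
  unfold lpNorm at hω ⊢
  split_ifs at hω ⊢ with hp_top
  · refine iSup_le fun x => (hpt x).trans ?_
    rw [hM, ← lintegral_mul_const _ hW]
    refine lintegral_mono_ae ?_
    filter_upwards [hω] with y hy
    rcases eq_or_ne (K y) 0 with h0 | h0
    · simp [h0]
    · rw [mul_comm]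
      gcongr
      exact (le_iSup (fun x => ‖g x y‖ₑ) x).trans (hy h0)
  · have hp0 : p ≠ 0 := (zero_lt_one.trans_le hp).ne'
    have hr1 : 1 ≤ p.toReal := by
      simpa using ENNReal.toReal_mono hp_top hp
    set r := p.toReal with hr
    have hr0 : 0 < r := by linarith
    set ν := haar.withDensity fun y => ‖K y‖ₑ with hν
    have hνM : ν Set.univ = M := by simp [hν, hM]
    have hνh : ν ≪ haar := withDensity_absolutelyContinuous _ _
    have hstep : ∀ᵐ x ∂haar, ‖∫ y, g x y * (K y : 𝕜) ∂haar‖ₑ ^ r ≤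
        (M ^ (1 - 1 / r)) ^ r * ∫⁻ y, ‖K y‖ₑ * ‖g x y‖ₑ ^ r ∂haar := by
      filter_upwards [hg.prodMk_left] with x hx
      have hx' : AEStronglyMeasurable (g x) haar := hx
      have h1 : ∫⁻ y, ‖g x y‖ₑ * ‖K y‖ₑ ∂haar = eLpNorm (g x) 1 ν := by
        rw [eLpNorm_one_eq_lintegral_enorm, hν,
          lintegral_withDensity_eq_lintegral_mul₀ hW.aemeasurable hx'.enorm]
        simp only [Pi.mul_apply, mul_comm]
      have h2 := eLpNorm_le_eLpNorm_mul_rpow_measure_univ hp (hx'.mono_ac hνh)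
      rw [hνM, ENNReal.toReal_one, div_one, ← hr] at h2
      have h3 : eLpNorm (g x) p ν ^ r = ∫⁻ y, ‖K y‖ₑ * ‖g x y‖ₑ ^ r ∂haar := by
        rw [eLpNorm_eq_lintegral_rpow_enorm_toReal hp0 hp_top, ← ENNReal.rpow_mul, ← hr,
          one_div_mul_cancel hr0.ne', ENNReal.rpow_one, hν,
          lintegral_withDensity_eq_lintegral_mul₀ hW.aemeasurable (hx'.enorm.pow_const r)]
        simp only [Pi.mul_apply]
      rw [← h3, ← ENNReal.mul_rpow_of_nonneg _ _ hr0.le, mul_comm]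
      exact ENNReal.rpow_le_rpow (((hpt x).trans h1.le).trans h2) hr0.le
    have hjoint : AEMeasurable (Function.uncurry fun x y => ‖K y‖ₑ * ‖g x y‖ₑ ^ r)
        (haar.prod haar) :=
      (hW.comp measurable_snd).aemeasurable.mul (hg.enorm.pow_const r)
    have hMr : (M ^ (1 - 1 / r)) ^ r ≠ ∞ :=
      ENNReal.rpow_ne_top_of_nonneg hr0.le (ENNReal.rpow_ne_top_of_nonneg
        (sub_nonneg.2 ((div_le_one hr0).2 hr1)) hMtop)
    have hinner : ∀ᵐ y ∂haar, ∫⁻ x, ‖K y‖ₑ * ‖g x y‖ₑ ^ r ∂haar ≤ ‖K y‖ₑ * ω ^ r := by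
      filter_upwards [hω] with y hy
      rw [lintegral_const_mul' _ _ enorm_ne_top]
      rcases eq_or_ne (K y) 0 with h0 | h0
      · simp [h0]
      · gcongr
        have := ENNReal.rpow_le_rpow (hy h0) hr0.le
        rwa [eLpNorm_eq_lintegral_rpow_enorm_toReal hp0 hp_top, ← ENNReal.rpow_mul, ← hr,
          one_div_mul_cancel hr0.ne', ENNReal.rpow_one] at this
    have hfin : ∫⁻ x, ‖∫ y, g x y * (K y : 𝕜) ∂haar‖ₑ ^ r ∂haar ≤ (M * ω) ^ r :=
      calc ∫⁻ x, ‖∫ y, g x y * (K y : 𝕜) ∂haar‖ₑ ^ r ∂haar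
          ≤ ∫⁻ x, (M ^ (1 - 1 / r)) ^ r * ∫⁻ y, ‖K y‖ₑ * ‖g x y‖ₑ ^ r ∂haar ∂haar :=
            lintegral_mono_ae hstep
        _ = (M ^ (1 - 1 / r)) ^ r * ∫⁻ y, ∫⁻ x, ‖K y‖ₑ * ‖g x y‖ₑ ^ r ∂haar ∂haar := by
            rw [lintegral_const_mul' _ _ hMr, lintegral_lintegral_swap hjoint]
        _ ≤ (M ^ (1 - 1 / r)) ^ r * (M * ω ^ r) := by
            gcongr
            rw [hM, ← lintegral_mul_const _ hW]
            exact lintegral_mono_ae hinner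
        _ = (M * ω) ^ r := by
            rw [← mul_assoc, ENNReal.mul_rpow_of_nonneg _ _ hr0.le, ← ENNReal.rpow_mul,
              sub_mul, one_div_mul_cancel hr0.ne', one_mul]
            congr 1
            nth_rewrite 2 [← ENNReal.rpow_one M]
            rw [← ENNReal.rpow_add_of_nonneg _ _ (by linarith) zero_le_one, sub_add_cancel]
    rw [eLpNorm_eq_lintegral_rpow_enorm_toReal hp0 hp_top, ← hr]
    calc _ ≤ ((M * ω) ^ r) ^ (1 / r) := ENNReal.rpow_le_rpow hfin (by positivity)
      _ = M * ω := by
        rw [← ENNReal.rpow_mul, mul_one_div_cancel hr0.ne', ENNReal.rpow_one]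

theorem InLp.aestronglyMeasurable {p : ℝ≥0∞} {f : DyadicGroup → 𝕜} (hf : InLp p f) :
    AEStronglyMeasurable f haar := by
  unfold InLp at hf
  split_ifs at hf
  · exact (integrable_of_continuous hf).1
  · exact hf.1

theorem InLp.integrable {p : ℝ≥0∞} (hp : 1 ≤ p) {f : DyadicGroup → 𝕜} (hf : InLp p f) :
    Integrable f haar := by
  unfold InLp at hf
  split_ifs at hf
  · exact integrable_of_continuous hf
  · exact hf.integrable hp

/-! ### Partial sums as convolutions -/

theorem add_self (x : DyadicGroup) : x + x = 0 :=
  funext fun i => CharTwo.add_self_eq_zero (x i)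

theorem walsh_mul_self (n : ℕ) (x : DyadicGroup) : walsh n x * walsh n x = 1 := by
  rw [← walsh_add, add_self]
  simp [walsh, rademacher]

@[fun_prop]
theorem continuous_partialSum (f : DyadicGroup → 𝕜) (k : ℕ) : Continuous (partialSum f k) := by
  unfold partialSum
  have h (j : ℕ) : Continuous fun x => (walsh j x : 𝕜) :=
    RCLike.continuous_ofReal.comp (continuous_walsh j)
  fun_prop

theorem integrable_comp_add_mul {f : DyadicGroup → 𝕜} (hf : Integrable f haar)
    {K : DyadicGroup → ℝ} (hK : Continuous K) (x : DyadicGroup) :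
    Integrable (fun y => f (x + y) * (K y : 𝕜)) haar := by
  have hc : Continuous fun y => (K y : 𝕜) := RCLike.continuous_ofReal.comp hK
  obtain ⟨C, hC⟩ := isCompact_univ.exists_bound_of_continuousOn hc.continuousOn
  exact (hf.comp_add_left x).mul_bdd (c := C) hc.aestronglyMeasurable
    (.of_forall fun y => hC y (Set.mem_univ y))

theorem partialSum_eq_integral {f : DyadicGroup → 𝕜} (hf : Integrable f haar) (k : ℕ)
    (x : DyadicGroup) :
    partialSum f k x = ∫ y, f (x + y) * (dirichlet k y : 𝕜) ∂haar := by
  have hj (j : ℕ) : walshCoeff f j * (walsh j x : 𝕜) =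
      ∫ y, f (x + y) * (walsh j y : 𝕜) ∂haar := by
    rw [walshCoeff, ← integral_mul_const, ← integral_add_left_eq_self _ x]
    refine integral_congr_ae (.of_forall fun y => ?_)
    have : (walsh j x : 𝕜) * (walsh j x : 𝕜) = 1 := by exact_mod_cast walsh_mul_self j x
    simp only [walsh_add, RCLike.ofReal_mul]
    linear_combination f (x + y) * (walsh j y : 𝕜) * this
  simp only [partialSum, hj, dirichlet, RCLike.ofReal_sum, Finset.mul_sum]
  rw [integral_finsetSum _ fun j _ => integrable_comp_add_mul hf (continuous_walsh j) x]

theorem aestronglyMeasurable_comp_add {f : DyadicGroup → 𝕜}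
    (hf : AEStronglyMeasurable f haar) (c : DyadicGroup) :
    AEStronglyMeasurable (Function.uncurry fun x y => f (x + (y + c))) (haar.prod haar) := by
  have h := (hf.comp_measurePreserving (measurePreserving_add_const c)).comp_quasiMeasurePreserving
    (quasiMeasurePreserving_add haar haar)
  convert h using 1
  ext z
  simp [Function.uncurry, add_assoc]

/-! ### Estimates by the modulus of continuity -/

theorem lpNorm_translate_sub_le (p : ℝ≥0∞) (f : DyadicGroup → 𝕜) {h : DyadicGroup} {δ : ℝ}
    (hh : size h < δ) : lpNorm p (fun x => f (x + h) - f x) ≤ modulus p f δ :=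
  le_iSup₂ (f := fun (h : DyadicGroup) (_ : size h < δ) => lpNorm p fun x => f (x + h) - f x) h hh

/-- `S_{2ᵐ} f` is the average of the translates of `f` by the elements whose first `m` coordinates
vanish, almost all of which have size less than `2⁻ᵐ`. -/
theorem lpNorm_partialSum_two_pow_sub_le {p : ℝ≥0∞} (hp : 1 ≤ p) {f : DyadicGroup → 𝕜}
    (hf : InLp p f) (m : ℕ) :
    lpNorm p (fun x => partialSum f (2 ^ m) x - f x) ≤ modulus p f (1 / 2 ^ m) := by
  have hint := hf.integrable hp
  have h1 (x : DyadicGroup) : partialSum f (2 ^ m) x - f x =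
      ∫ y, (f (x + y) - f x) * (dirichlet (2 ^ m) y : 𝕜) ∂haar := by
    simp only [sub_mul]
    rw [integral_sub (integrable_comp_add_mul hint (continuous_dirichlet _) x)
      (integrable_comp_add_mul (f := fun _ => f x) (integrable_const _)
        (continuous_dirichlet _) x), integral_const_mul, integral_ofReal,
      integral_dirichlet (by positivity), partialSum_eq_integral hint]
    simp
  simp only [h1]
  have hg : AEStronglyMeasurable (Function.uncurry fun x y => f (x + y) - f x)
      (haar.prod haar) := by
    have := aestronglyMeasurable_comp_add hf.aestronglyMeasurable 0
    simp only [add_zero] at this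
    exact this.sub hf.aestronglyMeasurable.comp_fst
  refine (lpNorm_integral_mul_le hp hg (continuous_dirichlet _)
    (ω := modulus p f (1 / 2 ^ m)) ?_).trans (le_of_eq ?_)
  · filter_upwards [ae_size_lt m] with y hy h0
    exact lpNorm_translate_sub_le p f (hy (eq_zero_of_dirichlet_two_pow_ne_zero h0))
  · rw [integral_abs_dirichlet_two_pow, ENNReal.ofReal_one, one_mul]

/-- The kernel `r_m ∑ s_i D_{i+1}` changes sign under translation by the basis element of index
`m`. Hence convolution with it is half the convolution with the difference of `f` and its
translate, and only half of the `L_1` norm of the kernel enters. -/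
theorem lpNorm_sum_partialSum_sub_le {p : ℝ≥0∞} (hp : 1 ≤ p) {f : DyadicGroup → 𝕜}
    (hf : InLp p f) {m L : ℕ} (hL : L < 2 ^ m) (s : ℕ → ℝ) (hs : ∀ i < L, 0 ≤ s i)
    (hanti : ∀ i j, i ≤ j → j < L → s j ≤ s i) :
    lpNorm p (fun x => ∑ i ∈ Finset.range L,
        (s i : 𝕜) * (partialSum f (2 ^ m + (i + 1)) x - partialSum f (2 ^ m) x)) ≤
      ENNReal.ofReal (∑ i ∈ Finset.range L, s i) * modulus p f (1 / 2 ^ m) := by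
  have hint := hf.integrable hp
  set P : DyadicGroup → ℝ := fun y => ∑ i ∈ Finset.range L, s i * dirichlet (i + 1) y with hP
  have hPc : Continuous P := by fun_prop
  set K : DyadicGroup → ℝ := fun y => 1 / 2 * (rademacher m y * P y) with hK
  have hKc : Continuous K := by fun_prop
  have hKe (y : DyadicGroup) : K (y + basisElem m) = -K y := by
    have : P (y + basisElem m) = P y := Finset.sum_congr rfl fun i hi => by
      rw [dirichlet_add_basisElem (by have := Finset.mem_range.1 hi; omega)]
    simp only [hK, this, rademacher_add, rademacher_basisElem_self]
    ring
  have h1 (x : DyadicGroup) : ∑ i ∈ Finset.range L,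
      (s i : 𝕜) * (partialSum f (2 ^ m + (i + 1)) x - partialSum f (2 ^ m) x) =
        ∫ y, (f (x + y) - f (x + (y + basisElem m))) * (K y : 𝕜) ∂haar := by
    have hflip : ∫ y, f (x + (y + basisElem m)) * (K y : 𝕜) ∂haar =
        -∫ y, f (x + y) * (K y : 𝕜) ∂haar := by
      rw [← integral_add_right_eq_self (fun y => f (x + y) * (K y : 𝕜)) (basisElem m),
        ← integral_neg]
      simp only [hKe, RCLike.ofReal_neg, mul_neg, neg_neg]
    have hi2 : Integrable (fun y => f (x + (y + basisElem m)) * (K y : 𝕜)) haar := by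
      have := integrable_comp_add_mul hint hKc (x + basisElem m)
      simpa only [add_assoc, add_comm (basisElem m)] using this
    simp only [sub_mul]
    rw [integral_sub (integrable_comp_add_mul hint hKc x) hi2, hflip, sub_neg_eq_add, ← two_mul,
      ← integral_const_mul]
    simp only [partialSum_eq_integral hint]
    have hi (i : ℕ) : Integrable (fun y => (s i : 𝕜) * (f (x + y) *
        (dirichlet (2 ^ m + (i + 1)) y : 𝕜) - f (x + y) * (dirichlet (2 ^ m) y : 𝕜))) haar :=
      ((integrable_comp_add_mul hint (continuous_dirichlet _) x).sub
        (integrable_comp_add_mul hint (continuous_dirichlet _) x)).const_mul _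
    rw [Finset.sum_congr rfl fun i _ => by
      rw [← integral_sub (integrable_comp_add_mul hint (continuous_dirichlet _) x)
        (integrable_comp_add_mul hint (continuous_dirichlet _) x), ← integral_const_mul],
      ← integral_finsetSum _ fun i _ => hi i]
    refine integral_congr_ae (.of_forall fun y => ?_)
    simp only [hK, hP, RCLike.ofReal_mul, RCLike.ofReal_sum, Finset.mul_sum]
    refine Finset.sum_congr rfl fun i hi => ?_
    rw [dirichlet_two_pow_add (by have := Finset.mem_range.1 hi; omega)]
    push_cast
    ring
  simp only [h1]
  have hg : AEStronglyMeasurable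
      (Function.uncurry fun x y => f (x + y) - f (x + (y + basisElem m))) (haar.prod haar) := by
    have := aestronglyMeasurable_comp_add hf.aestronglyMeasurable 0
    simp only [add_zero] at this
    exact this.sub (aestronglyMeasurable_comp_add hf.aestronglyMeasurable _)
  refine (lpNorm_integral_mul_le hp hg hKc (ω := modulus p f (1 / 2 ^ m))
    (.of_forall fun y _ => ?_)).trans ?_
  · -- By translation invariance this is the norm of `f - f(· + e_m)`.
    have hmeas : AEStronglyMeasurable (fun x => f (x + basisElem m) - f x) haar :=
      (hf.aestronglyMeasurable.comp_measurePreserving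
        (measurePreserving_add_const _)).sub hf.aestronglyMeasurable
    have h2 := lpNorm_comp_add_right p hmeas (y + basisElem m)
    have h3 (x : DyadicGroup) : x + (y + basisElem m) + basisElem m = x + y := by
      rw [add_assoc, add_assoc, add_self, add_zero]
    simp only [h3] at h2
    rw [h2]
    exact lpNorm_translate_sub_le p f (size_basisElem_lt m)
  · gcongr
    have := integral_abs_sum_dirichlet_le L s hs hanti
    simp only [hK, abs_mul, abs_rademacher, one_mul]
    rw [integral_const_mul, abs_of_pos (by norm_num)]
    linarith

/-- The contribution of the indices `2ᵐ, …, 2ᵐ + L` to the error, where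
`S_{2ᵐ+i} f - f = (S_{2ᵐ} f - f) + (S_{2ᵐ+i} f - S_{2ᵐ} f)`. -/
theorem lpNorm_block_le {p : ℝ≥0∞} (hp : 1 ≤ p) {f : DyadicGroup → 𝕜}
    (hf : InLp p f) {m L : ℕ} (hL : L < 2 ^ m) (s : ℕ → ℝ) (hs : ∀ i ≤ L, 0 ≤ s i)
    (hanti : ∀ i j, i ≤ j → j ≤ L → s j ≤ s i) :
    lpNorm p (fun x => ∑ i ∈ Finset.range (L + 1),
        (s i : 𝕜) * (partialSum f (2 ^ m + i) x - f x)) ≤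
      ENNReal.ofReal (∑ i ∈ Finset.range (L + 1), s i + ∑ i ∈ Finset.range L, s (i + 1)) *
        modulus p f (1 / 2 ^ m) := by
  have h1 (x : DyadicGroup) : ∑ i ∈ Finset.range (L + 1),
      (s i : 𝕜) * (partialSum f (2 ^ m + i) x - f x) =
        ((∑ i ∈ Finset.range (L + 1), s i : ℝ) : 𝕜) * (partialSum f (2 ^ m) x - f x) +
          ∑ i ∈ Finset.range L, (s (i + 1) : 𝕜) *
            (partialSum f (2 ^ m + (i + 1)) x - partialSum f (2 ^ m) x) := by
    have : ∑ i ∈ Finset.range L, (s (i + 1) : 𝕜) *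
        (partialSum f (2 ^ m + (i + 1)) x - partialSum f (2 ^ m) x) =
          ∑ i ∈ Finset.range (L + 1), (s i : 𝕜) *
            (partialSum f (2 ^ m + i) x - partialSum f (2 ^ m) x) := by
      rw [Finset.sum_range_succ']
      simp
    rw [this, RCLike.ofReal_sum, Finset.sum_mul, ← Finset.sum_add_distrib]
    exact Finset.sum_congr rfl fun i _ => by ring
  have hA : 0 ≤ ∑ i ∈ Finset.range (L + 1), s i :=
    Finset.sum_nonneg fun i hi => hs i (Nat.lt_succ_iff.1 (Finset.mem_range.1 hi))
  have hB : 0 ≤ ∑ i ∈ Finset.range L, s (i + 1) :=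
    Finset.sum_nonneg fun i hi => hs _ (Finset.mem_range.1 hi)
  simp only [h1]
  rw [ENNReal.ofReal_add hA hB, add_mul]
  refine (lpNorm_add_le hp ?_ ?_).trans (add_le_add ?_ ?_)
  · exact ((continuous_partialSum f _).aestronglyMeasurable.sub
      hf.aestronglyMeasurable).const_mul _
  · exact Continuous.aestronglyMeasurable (by fun_prop)
  · rw [lpNorm_const_mul]
    refine mul_le_mul' (le_of_eq ?_) (lpNorm_partialSum_two_pow_sub_le hp hf m)
    rw [← ofReal_norm, RCLike.norm_ofReal, abs_of_nonneg hA]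
  · exact lpNorm_sum_partialSum_sub_le hp hf hL (fun i => s (i + 1)) (fun i hi => hs _ hi)
      (fun i j hij hj => hanti _ _ (Nat.succ_le_succ hij) hj)

/-! ### Dyadic decomposition of the error -/

theorem sum_Ico_one_two_pow {M : Type*} [AddCommMonoid M] (u : ℕ → M) (N : ℕ) :
    ∑ k ∈ Finset.Ico 1 (2 ^ N), u k =
      ∑ m ∈ Finset.range N, ∑ i ∈ Finset.range (2 ^ m), u (2 ^ m + i) := by
  induction N with
  | zero => simp
  | succ N ih =>
    rw [Finset.sum_range_succ, ← ih,
      ← Finset.sum_Ico_consecutive u (Nat.one_le_two_pow (n := N))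
        (Nat.pow_le_pow_right two_pos N.le_succ), Finset.sum_Ico_eq_sum_range u (2 ^ N)]
    congr 3
    rw [pow_succ]
    omega

theorem sum_Icc_one_two_pow_add {M : Type*} [AddCommMonoid M] (u : ℕ → M) (N L : ℕ) :
    ∑ k ∈ Finset.Icc 1 (2 ^ N + L), u k =
      ∑ m ∈ Finset.range N, ∑ i ∈ Finset.range (2 ^ m), u (2 ^ m + i) +
        ∑ i ∈ Finset.range (L + 1), u (2 ^ N + i) := by
  rw [← sum_Ico_one_two_pow, ← Finset.Ico_succ_right_eq_Icc, Order.succ_eq_add_one,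
    ← Finset.sum_Ico_consecutive u (Nat.one_le_two_pow (n := N)) (by omega),
    Finset.sum_Ico_eq_sum_range u (2 ^ N)]
  congr 3
  omega

end DyadicGroup

theorem theorem4p1 {𝕜 : Type*} [RCLike 𝕜] (p : ENNReal) (hp : 1 ≤ p)
    (f : DyadicGroup → 𝕜) (hf : DyadicGroup.InLp p f)
    (t : ℕ → ℕ → ℝ) (n : ℕ) (hn : 1 ≤ n)
    (ht_nonneg : ∀ k ∈ Finset.Icc 1 n, 0 ≤ t k n)
    (ht_sum : ∑ k ∈ Finset.Icc 1 n, t k n = 1)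
    (ht_anti : AntitoneOn (fun k => t k n) (Set.Icc 1 n)) :
    DyadicGroup.lpNorm p (fun x => DyadicGroup.matrixMean t n f x - f x) ≤
      ENNReal.ofReal (31 / 15) *
          ∑ k ∈ Finset.range (DyadicGroup.order n),
            ENNReal.ofReal (2 ^ k * t (2 ^ k) n) *
              DyadicGroup.modulus p f (1 / 2 ^ k) +
        ENNReal.ofReal (47 / 30) * DyadicGroup.modulus p f (1 / 2 ^ DyadicGroup.order n) := by
  have hN1 : 2 ^ DyadicGroup.order n ≤ n := Nat.pow_log_le_self 2 (by omega)
  have hN2 : n < 2 ^ (DyadicGroup.order n + 1) := Nat.lt_pow_succ_log_self one_lt_two n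
  set N := DyadicGroup.order n
  obtain ⟨L, hL⟩ := Nat.exists_eq_add_of_le hN1
  have hLN : L < 2 ^ N := by rw [pow_succ] at hN2; omega
  have hpos (m : ℕ) : 1 ≤ 2 ^ m := Nat.one_le_two_pow
  have hnn : ∀ k, 1 ≤ k → k ≤ n → 0 ≤ t k n := fun k h1 h2 =>
    ht_nonneg k (Finset.mem_Icc.2 ⟨h1, h2⟩)
  have hle : ∀ j k, 1 ≤ j → j ≤ k → k ≤ n → t k n ≤ t j n := fun j k h1 h2 h3 =>
    ht_anti ⟨h1, h2.trans h3⟩ ⟨h1.trans h2, h3⟩ h2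
  -- The error is a sum over dyadic blocks of indices, the last of them incomplete.
  have herr (x : DyadicGroup) : DyadicGroup.matrixMean t n f x - f x =
      ∑ m ∈ Finset.range N, ∑ i ∈ Finset.range (2 ^ m - 1 + 1),
        (t (2 ^ m + i) n : 𝕜) * (DyadicGroup.partialSum f (2 ^ m + i) x - f x) +
      ∑ i ∈ Finset.range (L + 1),
        (t (2 ^ N + i) n : 𝕜) * (DyadicGroup.partialSum f (2 ^ N + i) x - f x) := by
    have h1 : ∑ k ∈ Finset.Icc 1 n, (t k n : 𝕜) = 1 := by exact_mod_cast ht_sum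
    simp only [Nat.sub_add_cancel (hpos _)]
    rw [← DyadicGroup.sum_Icc_one_two_pow_add
      (fun k => (t k n : 𝕜) * (DyadicGroup.partialSum f k x - f x)), ← hL]
    simp only [mul_sub, Finset.sum_sub_distrib, ← Finset.sum_mul, h1, one_mul]
    rfl
  have hcont (k : ℕ) : AEStronglyMeasurable
      (fun x => (t k n : 𝕜) * (DyadicGroup.partialSum f k x - f x)) DyadicGroup.haar :=
    ((DyadicGroup.continuous_partialSum f k).aestronglyMeasurable.sub
      hf.aestronglyMeasurable).const_mul _
  have hblock (m : ℕ) (A : ℕ) := Finset.aestronglyMeasurable_fun_sum (Finset.range A)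
    fun i _ => hcont (2 ^ m + i)
  simp only [herr]
  refine (DyadicGroup.lpNorm_add_le hp
    (Finset.aestronglyMeasurable_fun_sum _ fun m _ => hblock m _) (hblock N _)).trans
      (add_le_add ((DyadicGroup.lpNorm_sum_le hp _ fun m => hblock m _).trans ?_) ?_)
  · rw [Finset.mul_sum]
    refine Finset.sum_le_sum fun m hm => ?_
    have hmN : 2 ^ (m + 1) ≤ n :=
      (Nat.pow_le_pow_right two_pos (Finset.mem_range.1 hm)).trans hN1
    rw [pow_succ] at hmN
    have hm1 := hpos m
    refine (DyadicGroup.lpNorm_block_le hp hf (by omega) (fun i => t (2 ^ m + i) n)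
      (fun i hi => hnn _ (by omega) (by omega))
      fun i j hij hj => hle _ _ (by omega) (by omega) (by omega)).trans ?_
    rw [← mul_assoc, ← ENNReal.ofReal_mul (by norm_num)]
    gcongr
    have hτ := hnn (2 ^ m) (by omega) (by omega)
    have hA : ∑ i ∈ Finset.range (2 ^ m - 1 + 1), t (2 ^ m + i) n ≤ 2 ^ m * t (2 ^ m) n := by
      refine (Finset.sum_le_card_nsmul _ _ (t (2 ^ m) n) fun i hi => ?_).trans (le_of_eq ?_)
      · have := Finset.mem_range.1 hi
        exact hle _ _ (by omega) (by omega) (by omega)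
      · simp [Nat.sub_add_cancel hm1]
    have hB : ∑ i ∈ Finset.range (2 ^ m - 1), t (2 ^ m + (i + 1)) n ≤
        ∑ i ∈ Finset.range (2 ^ m - 1 + 1), t (2 ^ m + i) n := by
      rw [Finset.sum_range_succ']
      simpa using hτ
    nlinarith [mul_nonneg (pow_nonneg (zero_le_two (α := ℝ)) m) hτ]
  · refine (DyadicGroup.lpNorm_block_le hp hf hLN (fun i => t (2 ^ N + i) n)
      (fun i hi => hnn _ (by have := hpos N; omega) (by omega))
      fun i j hij hj => hle _ _ (by have := hpos N; omega) (by omega) (by omega)).trans ?_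
    gcongr
    have hτ := hnn (2 ^ N) (hpos N) hN1
    set S := ∑ i ∈ Finset.range (L + 1), t (2 ^ N + i) n with hS
    have htot : ∑ k ∈ Finset.Ico 1 (2 ^ N), t k n + S = 1 := by
      have h := DyadicGroup.sum_Icc_one_two_pow_add (fun k => t k n) N L
      rw [← hL, ht_sum] at h
      rw [DyadicGroup.sum_Ico_one_two_pow]
      exact h.symm
    rcases Nat.eq_zero_or_pos N with hN0 | hN0
    · have hL0 : L = 0 := by rw [hN0] at hLN; omega
      have hT : 0 ≤ ∑ k ∈ Finset.Ico 1 (2 ^ N), t k n := Finset.sum_nonneg fun k hk => by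
        have := Finset.mem_Ico.1 hk
        exact hnn k this.1 (by omega)
      simp only [hL0, Finset.range_zero, Finset.sum_empty]
      linarith
    · -- The weights of the last block sum to at most `2 / 3`, as the `2 ^ N - 1 ≥ 2 ^ N / 2`
      -- preceding ones are at least `t (2 ^ N) n` and its own at most that.
      have hA : S ≤ 2 ^ N * t (2 ^ N) n := by
        refine (Finset.sum_le_card_nsmul _ _ (t (2 ^ N) n) fun i hi => ?_).trans ?_
        · have := Finset.mem_range.1 hi
          exact hle _ _ (hpos N) (by omega) (by omega)
        · rw [Finset.card_range, nsmul_eq_mul]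
          gcongr
          exact_mod_cast hLN
      have hB : ∑ i ∈ Finset.range L, t (2 ^ N + (i + 1)) n ≤ S := by
        rw [hS, Finset.sum_range_succ']
        simpa using hτ
      have hT : (2 ^ N - 1) * t (2 ^ N) n ≤ ∑ k ∈ Finset.Ico 1 (2 ^ N), t k n := by
        refine le_trans (le_of_eq ?_)
          (Finset.card_nsmul_le_sum _ _ (t (2 ^ N) n) fun k hk => ?_)
        · rw [Nat.card_Ico, nsmul_eq_mul, Nat.cast_sub (hpos N)]
          push_cast
          rfl
        · have := Finset.mem_Ico.1 hk
          exact hle _ _ this.1 this.2.le hN1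
      have h2 : (2 : ℝ) ≤ 2 ^ N := by
        simpa using pow_le_pow_right₀ (one_le_two (α := ℝ)) hN0
      nlinarith [mul_nonneg (sub_nonneg.2 h2) hτ]
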